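/- **Theorem (Stronger stability of Wasserstein medians).** Let $(\mathcal X,d)$ be a proper metric space (closed balls are compact). Let $\mathcal P_1(\mathcal X)$ be the set of Borel probability measures on $\mathcal X$ with finite first moment, endowed with the Wasserstein distance $$W_1(\mu,\nu)=\inf_{\gamma\in\Pi(\mu,\nu)}\int_{\mathcal X^2}d(x,y)\,\mathrm d\gamma(x,y),$$ where $\Pi(\mu,\nu)$ is the set of Borel probability measures on $\mathcal X^2$ with marginals $\mu$ and $\nu$. Let $N\ge 1$ and $\Delta_N=\{\lambda\in\mathbb R_+^N:\sum_{i=1}^N\lambda_i=1\}$. For $\lambda\in\Delta_N$ and $\boldsymbol\nu=(\nu_1,\dots,\nu_N)\in\mathcal P_1(\mathcal X)^N$, let $\mathrm{Med}_\lambda(\boldsymbol\nu)$ be the set of Wasserstein medians, i.e. of minimizers over $\mu\in\mathcal P_1(\mathcal X)$ of $\sum_{i=1}^N\lambda_iW_1(\nu_i,\mu)$. Then: 1. Let $(\lambda,\boldsymbol\nu)\in\Delta_N\times\mathcal P_1(\mathcal X)^N$, let $(\lambda^n,\boldsymbol\nu^n)_{n\in\mathbb N}$ be a sequence in $\Delta_N\times\mathcal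 P_1(\mathcal X)^N$ such that $$\sum_{i=1}^N|\lambda_i^n-\lambda_i|+\max_{1\le i\le N}W_1(\nu_i^n,\nu_i)\to 0\quad\text{as } n\to\infty,$$ and let $\mu^n\in\mathrm{Med}_{\lambda^n}(\boldsymbol\nu^n)$ for all $n\in\mathbb N$. Then $(\mu^n)_{n\in\mathbb N}$ has a subsequence that converges for $W_1$ to some $\mu\in\mathrm{Med}_\lambda(\boldsymbol\nu)$. 2. For every $(\lambda,\boldsymbol\nu)\in\Delta_N\times\mathcal P_1(\mathcal X)^N$, the set $\mathrm{Med}_\lambda(\boldsymbol\nu)$ is compact in $(\mathcal P_1(\mathcal X),W_1)$. 3. The set-valued map $(\lambda,\boldsymbol\nu)\mapsto\mathrm{Med}_\lambda(\boldsymbol\nu)$ has closed graph for $W_1$: the set $\{(\lambda,\boldsymbol\nu,\mu):\mu\in\mathrm{Med}_\lambda(\boldsymbol\nu)\}$ is closed in $\Delta_N\times\mathcal P_1(\mathcal X)^N\times\mathcal P_1(\mathcal X)$. -/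

import Mathlib

open Filter Topology MeasureTheory ProbabilityTheory
open scoped ENNReal NNReal

namespace WassersteinMedian

/-- The Borel probability measures on `X` with finite first moment. -/
@[ext]
structure P1 (X : Type*) [MetricSpace X] [MeasurableSpace X] where
  /-- the underlying measure -/
  toMeasure : Measure X
  isProbabilityMeasure : IsProbabilityMeasure toMeasure
  finite_moment : ∃ x₀ : X, Integrable (fun x => dist x₀ x) toMeasure

/-- The transport plans between `μ` and `ν`: the measures on `X × X` with marginals `μ` and `ν`. -/
def plans {X : Type*} [MeasurableSpace X] (μ ν : Measure X) : Set (Measure (X × X)) :=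
  {γ | γ.map Prod.fst = μ ∧ γ.map Prod.snd = ν}

/-- The optimal transport cost for the cost function `d`, as an extended nonnegative number. -/
noncomputable def cost {X : Type*} [MetricSpace X] [MeasurableSpace X] (μ ν : Measure X) : ℝ≥0∞ :=
  ⨅ γ ∈ plans μ ν, ∫⁻ p, edist p.1 p.2 ∂γ

/-- The Wasserstein distance of order one, a real number (the cost is finite on `P1 X`,
see `cost_ne_top`). -/
noncomputable def W1 {X : Type*} [MetricSpace X] [MeasurableSpace X] (μ ν : P1 X) : ℝ :=
  (cost μ.toMeasure ν.toMeasure).toReal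

section Metric

variable {X : Type*} [MetricSpace X] [MeasurableSpace X]

theorem cost_le {μ ν : Measure X} {γ : Measure (X × X)} (h : γ ∈ plans μ ν) :
    cost μ ν ≤ ∫⁻ p, edist p.1 p.2 ∂γ :=
  iInf₂_le γ h

variable [ProperSpace X] [BorelSpace X]

theorem cost_self (μ : Measure X) : cost μ μ = 0 := by
  have h : μ.map (fun x => (x, x)) ∈ plans μ μ := by
    constructor
    · rw [Measure.map_map (by fun_prop) (by fun_prop)]
      exact Measure.map_id
    · rw [Measure.map_map (by fun_prop) (by fun_prop)]
      exact Measure.map_id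
  have h2 := cost_le h
  rw [lintegral_map (by fun_prop) (by fun_prop)] at h2
  simpa using h2

theorem cost_comm_le (μ ν : Measure X) : cost μ ν ≤ cost ν μ := by
  refine le_iInf₂ fun γ hγ => ?_
  have h : γ.map Prod.swap ∈ plans μ ν := by
    constructor
    · rw [Measure.map_map (by fun_prop) (by fun_prop)]
      exact hγ.2
    · rw [Measure.map_map (by fun_prop) (by fun_prop)]
      exact hγ.1
  have h2 := cost_le h
  rw [lintegral_map (by fun_prop) (by fun_prop)] at h2
  simpa [edist_comm] using h2

theorem cost_triangle (μ ν ρ : Measure X) [IsProbabilityMeasure μ] :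
    cost μ ρ ≤ cost μ ν + cost ν ρ := by
  have : Nonempty X := nonempty_of_isProbabilityMeasure μ
  simp only [cost, ENNReal.iInf_add, ENNReal.add_iInf]
  refine le_iInf₂ fun η hη => le_iInf₂ fun γ hγ => ?_
  have : IsProbabilityMeasure (γ.map Prod.fst) := by rw [hγ.1]; infer_instance
  have hγp : IsProbabilityMeasure γ := Measure.isProbabilityMeasure_of_map (f := Prod.fst)
  have hν : IsProbabilityMeasure ν := by
    rw [← hγ.2]; exact Measure.isProbabilityMeasure_map (by fun_prop)
  have : IsProbabilityMeasure (η.map Prod.fst) := by rw [hη.1]; infer_instance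
  have hηp : IsProbabilityMeasure η := Measure.isProbabilityMeasure_of_map (f := Prod.fst)
  let κ : Kernel (X × X) X := η.condKernel.comap Prod.snd measurable_snd
  let θ : Measure ((X × X) × X) := γ ⊗ₘ κ
  have h1 : θ.map Prod.fst = γ := Measure.fst_compProd γ κ
  have h2 : θ.map (fun p => (p.1.2, p.2)) = η := by
    have hη' : ν ⊗ₘ η.condKernel = η := by
      have := η.disintegrate η.condKernel
      rwa [Measure.fst, hη.1] at this
    conv_rhs => rw [← hη']
    ext s hs
    rw [Measure.map_apply (by fun_prop) hs, Measure.compProd_apply hs,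
      Measure.compProd_apply (hs.preimage (by fun_prop)), ← hγ.2,
      lintegral_map (Kernel.measurable_kernel_prodMk_left hs) (by fun_prop)]
    rfl
  have h3 : θ.map (fun p => (p.1.1, p.2)) ∈ plans μ ρ := by
    constructor
    · rw [Measure.map_map (by fun_prop) (by fun_prop), ← hγ.1]
      conv_rhs => rw [← h1]
      rw [Measure.map_map (by fun_prop) (by fun_prop)]
      rfl
    · rw [Measure.map_map (by fun_prop) (by fun_prop), ← hη.2]
      conv_rhs => rw [← h2]
      rw [Measure.map_map (by fun_prop) (by fun_prop)]
      rfl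
  calc cost μ ρ ≤ _ := cost_le h3
    _ = ∫⁻ p, edist p.1.1 p.2 ∂θ := lintegral_map (by fun_prop) (by fun_prop)
    _ ≤ ∫⁻ p, (edist p.1.1 p.1.2 + edist p.1.2 p.2) ∂θ :=
      lintegral_mono fun p => edist_triangle _ _ _
    _ = ∫⁻ p, edist p.1.1 p.1.2 ∂θ + ∫⁻ p, edist p.1.2 p.2 ∂θ :=
      lintegral_add_left (by fun_prop) _
    _ = ∫⁻ p, edist p.1 p.2 ∂γ + ∫⁻ p, edist p.1 p.2 ∂η := by
      conv_rhs => rw [← h1, ← h2]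
      rw [lintegral_map (by fun_prop) (by fun_prop), lintegral_map (by fun_prop) (by fun_prop)]

theorem lintegral_le_add_cost {μ ν : Measure X} {K : ℝ≥0} {f : X → ℝ≥0}
    (hf : LipschitzWith K f) (h0 : cost μ ν = 0) : ∫⁻ x, f x ∂μ ≤ ∫⁻ x, f x ∂ν := by
  have hm : Measurable f := hf.continuous.measurable
  have key : ∫⁻ x, f x ∂μ ≤ ∫⁻ x, f x ∂ν + (K + 1 : ℝ≥0) * cost μ ν := by
    have hK : ((K + 1 : ℝ≥0) : ℝ≥0∞) ≠ 0 := by simp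
    simp only [cost, ENNReal.mul_iInf_of_ne hK ENNReal.coe_ne_top, ENNReal.add_iInf]
    refine le_iInf₂ fun γ hγ => ?_
    rw [← hγ.1, ← hγ.2, lintegral_map (by fun_prop) (by fun_prop),
      lintegral_map (by fun_prop) (by fun_prop), ← lintegral_const_mul _ (by fun_prop),
      ← lintegral_add_left (by fun_prop)]
    refine lintegral_mono fun p => ?_
    have h1 := (hf.weaken (le_add_of_nonneg_right zero_le_one) : LipschitzWith (K + 1) f) p.1 p.2
    have h2 : (f p.1 : ℝ≥0∞) ≤ f p.2 + edist (f p.1) (f p.2) := by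
      rw [edist_nndist, ← ENNReal.coe_add, ENNReal.coe_le_coe, ← NNReal.coe_le_coe]
      have := le_abs_self ((f p.1 : ℝ) - f p.2)
      rw [← NNReal.dist_eq] at this
      push_cast
      linarith
    exact h2.trans (by gcongr)
  simpa [h0] using key

theorem eq_of_cost_eq_zero {μ ν : Measure X} [IsProbabilityMeasure μ] [IsProbabilityMeasure ν]
    (h : cost μ ν = 0) : μ = ν := by
  have h' : cost ν μ = 0 := le_antisymm ((cost_comm_le ν μ).trans h.le) zero_le
  have key : ∀ F : Set X, IsClosed F → μ F = ν F := by
    intro F hF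
    have hpos : ∀ n : ℕ, (0 : ℝ) < 1 / ((n : ℝ) + 1) := fun n => Nat.one_div_pos_of_nat
    have t1 := tendsto_lintegral_thickenedIndicator_of_isClosed μ hF hpos
      tendsto_one_div_add_atTop_nhds_zero_nat
    have t2 := tendsto_lintegral_thickenedIndicator_of_isClosed ν hF hpos
      tendsto_one_div_add_atTop_nhds_zero_nat
    refine tendsto_nhds_unique t1 (t2.congr fun n => ?_)
    exact le_antisymm (lintegral_le_add_cost (lipschitzWith_thickenedIndicator (hpos n) F) h')
      (lintegral_le_add_cost (lipschitzWith_thickenedIndicator (hpos n) F) h)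
  refine ext_of_generate_finite _ ?_ isPiSystem_isClosed (fun F hF => key F hF) (key _ isClosed_univ)
  rw [BorelSpace.measurable_eq (α := X), borel_eq_generateFrom_isClosed]

theorem cost_ne_top (μ ν : P1 X) : cost μ.toMeasure ν.toMeasure ≠ ∞ := by
  have := μ.isProbabilityMeasure
  have := ν.isProbabilityMeasure
  obtain ⟨a, ha⟩ := μ.finite_moment
  obtain ⟨b, hb⟩ := ν.finite_moment
  have fin : ∀ (c : X) (ρ : Measure X), Integrable (fun x => dist c x) ρ →
      ∫⁻ x, edist c x ∂ρ ≠ ∞ := by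
    intro c ρ h
    have := h.lintegral_lt_top.ne
    simpa [edist_dist] using this
  have hp : μ.toMeasure.prod ν.toMeasure ∈ plans μ.toMeasure ν.toMeasure := by
    simp [plans]
  refine ne_top_of_le_ne_top ?_ (cost_le hp)
  have h1 : ∫⁻ p, edist p.1 p.2 ∂(μ.toMeasure.prod ν.toMeasure) ≤
      ∫⁻ p, (edist a p.1 + (edist a b + edist b p.2)) ∂(μ.toMeasure.prod ν.toMeasure) := by
    refine lintegral_mono fun p => ?_
    rw [edist_comm a p.1]
    exact (edist_triangle _ a _).trans (by gcongr; exact edist_triangle _ _ _)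
  refine ne_top_of_le_ne_top ?_ h1
  rw [lintegral_add_left (by fun_prop), lintegral_add_left (by fun_prop)]
  have e1 : ∫⁻ p, edist a p.1 ∂(μ.toMeasure.prod ν.toMeasure) = ∫⁻ x, edist a x ∂μ.toMeasure := by
    conv_rhs => rw [← hp.1]
    rw [lintegral_map (by fun_prop) (by fun_prop)]
  have e2 : ∫⁻ p, edist b p.2 ∂(μ.toMeasure.prod ν.toMeasure) = ∫⁻ x, edist b x ∂ν.toMeasure := by
    conv_rhs => rw [← hp.2]
    rw [lintegral_map (by fun_prop) (by fun_prop)]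
  rw [e1, e2]
  simp [fin a _ ha, fin b _ hb, edist_ne_top]

/-- The space `P1 X` endowed with the distance `W1`. -/
noncomputable instance instMetricSpaceP1 : MetricSpace (P1 X) where
  dist := W1
  dist_self μ := by simp [W1, cost_self]
  dist_comm μ ν := by
    unfold W1
    rw [le_antisymm (cost_comm_le μ.toMeasure ν.toMeasure) (cost_comm_le _ _)]
  dist_triangle μ ν ρ := by
    have := μ.isProbabilityMeasure
    unfold W1
    rw [← ENNReal.toReal_add (cost_ne_top _ _) (cost_ne_top _ _)]
    exact ENNReal.toReal_mono (ENNReal.add_ne_top.2 ⟨cost_ne_top _ _, cost_ne_top _ _⟩)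
      (cost_triangle _ _ _)
  eq_of_dist_eq_zero := by
    intro μ ν h
    have := μ.isProbabilityMeasure
    have := ν.isProbabilityMeasure
    refine P1.ext (eq_of_cost_eq_zero ?_)
    exact ((ENNReal.toReal_eq_zero_iff _).1 h).resolve_right (cost_ne_top μ ν)

theorem dist_eq_W1 (μ ν : P1 X) : dist μ ν = W1 μ ν := rfl

end Metric

/-- The weighted dispersion functional `μ ↦ ∑ i, lam i * W1 (ν i) μ`. -/
noncomputable def dispersion {X : Type*} [MetricSpace X] [MeasurableSpace X] {N : ℕ}
    (lam : stdSimplex ℝ (Fin N)) (ν : Fin N → P1 X) (μ : P1 X) : ℝ :=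
  ∑ i, lam.1 i * W1 (ν i) μ

/-- The set of Wasserstein medians of `ν` with weights `lam`: the minimizers over `P1 X` of the
dispersion functional. -/
def Med {X : Type*} [MetricSpace X] [MeasurableSpace X] {N : ℕ}
    (lam : stdSimplex ℝ (Fin N)) (ν : Fin N → P1 X) : Set (P1 X) :=
  {μ | ∀ ρ : P1 X, dispersion lam ν μ ≤ dispersion lam ν ρ}

end WassersteinMedian

/-!
Medians form a sequentially compact family for `W1`, although sublevel sets of the dispersion are
only narrowly compact.

Comparing a median with a fixed competitor bounds its first moment
(`dist_le_two_mul_dispersion`), so by Prokhorov's theorem a sequence of medians `μₙ` has a narrow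
limit point `μ`. Near-optimal plans from a fixed `ν i` to `μₙ` have narrow limit points as well, and
these are plans from `ν i` to `μ`; hence `W1 (ν i)` is lower semicontinuous for narrow convergence
(`exists_subseq_tendsto_near_optimal_plans`) and `μ` is a median of the limit data. Minimality of
`μₙ` and of `μ` then shows that no cost is lost in the limit: `W1 (ν i) μₙ` tends to `W1 (ν i) μ`
for each `i` of positive weight.

Convergence of the distances to one point of `P1 X` upgrades narrow convergence to convergence for
`W1`. The triangle inequality defect `d(x₀, x) + d(x, y) - d(x₀, y)` is continuous and nonnegative,
so its integral against the plans is lower semicontinuous. As the integrals of the first two terms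
converge, the first moments of `μₙ` cannot exceed that of `μ` in the limit
(`exists_subseq_tendsto_moment`). Narrow convergence with convergence of first moments implies
convergence of the costs (`tendsto_cost_zero`): a fine continuous partition of unity discretizes all
the measures at once with small cost, and the weights of the discretizations converge.

Compactness of the set of medians is the case of constant data. The graph is closed because the
dispersion is jointly continuous for `W1`.
-/

namespace WassersteinMedian

/-! ### Narrow compactness from first moments -/

section Narrow

variable {Y : Type*} [MetricSpace Y] [MeasurableSpace Y] [BorelSpace Y]

/-- Integrals of nonnegative continuous functions, bounded or not, are lower semicontinuous for
narrow convergence; stated for integrals that have a limit along the sequence. -/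
theorem lintegral_le_of_tendsto {ρn : ℕ → ProbabilityMeasure Y} {ρ : ProbabilityMeasure Y}
    (h : Tendsto ρn atTop (𝓝 ρ)) {f : Y → ℝ} (hf : Continuous f) (h0 : 0 ≤ f) {c : ℝ≥0∞}
    (hc : Tendsto (fun n => ∫⁻ y, ENNReal.ofReal (f y) ∂(ρn n : Measure Y)) atTop (𝓝 c)) :
    ∫⁻ y, ENNReal.ofReal (f y) ∂(ρ : Measure Y) ≤ c := by
  rw [← hc.liminf_eq]
  exact lintegral_le_liminf_lintegral_of_forall_isOpen_measure_le_liminf_measure hf h0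
    fun G hG => ProbabilityMeasure.le_liminf_measure_open_of_tendsto h hG

theorem tendsto_lintegral_of_le {ρn : ℕ → ProbabilityMeasure Y} {ρ : ProbabilityMeasure Y}
    (hρ : Tendsto ρn atTop (𝓝 ρ)) {f : Y → ℝ≥0} (hf : Continuous f) {C : ℝ≥0} (hC : ∀ x, f x ≤ C) :
    Tendsto (fun n => ∫⁻ y, f y ∂(ρn n : Measure Y)) atTop (𝓝 (∫⁻ y, f y ∂(ρ : Measure Y))) := by
  refine ProbabilityMeasure.tendsto_iff_forall_lintegral_tendsto.1 hρ
    (BoundedContinuousFunction.mkOfBound ⟨f, hf⟩ C fun x y => ?_)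
  rw [NNReal.dist_eq, abs_sub_le_iff]
  have h1 : (f x : ℝ) ≤ C := hC x
  have h2 : (f y : ℝ) ≤ C := hC y
  have h3 := (f x).coe_nonneg
  have h4 := (f y).coe_nonneg
  exact ⟨by simp; linarith, by simp; linarith⟩

/-- By Markov's inequality and Prokhorov's theorem, bounded first moments give narrow compactness
on a space whose closed balls are compact. -/
theorem exists_subseq_tendsto_of_moment_le [ProperSpace Y] (ρn : ℕ → ProbabilityMeasure Y) (y₀ : Y)
    {C : ℝ≥0∞} (hC : C ≠ ∞) (h : ∀ n, ∫⁻ y, edist y₀ y ∂(ρn n : Measure Y) ≤ C) :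
    ∃ ρ : ProbabilityMeasure Y, ∃ φ : ℕ → ℕ, StrictMono φ ∧ Tendsto (ρn ∘ φ) atTop (𝓝 ρ) := by
  have ht : IsTightMeasureSet {((μ : ProbabilityMeasure Y) : Measure Y) | μ ∈ Set.range ρn} := by
    rw [isTightMeasureSet_iff_exists_isCompact_measure_compl_le]
    intro ε hε
    obtain ⟨R, hR, hR0⟩ : ∃ R : ℝ≥0, C / R < ε ∧ R ≠ 0 := by
      have : Tendsto (fun R : ℕ => C / (R : ℝ≥0∞)) atTop (𝓝 0) := by
        simpa using ENNReal.Tendsto.const_div ENNReal.tendsto_nat_nhds_top (Or.inr hC)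
      obtain ⟨R, hR, hR0⟩ := ((this.eventually (gt_mem_nhds hε)).and (eventually_ne_atTop 0)).exists
      exact ⟨R, by simpa using hR, by simpa using hR0⟩
    refine ⟨Metric.closedBall y₀ R, isCompact_closedBall _ _, ?_⟩
    rintro _ ⟨_, ⟨n, rfl⟩, rfl⟩
    refine le_trans ?_ hR.le
    refine le_trans (measure_mono ?_) ((meas_ge_le_lintegral_div (f := fun y => edist y₀ y)
      (by fun_prop) (ENNReal.coe_ne_zero.2 hR0) ENNReal.coe_ne_top).trans (by gcongr; exact h n))
    intro y hy
    simp only [Set.mem_compl_iff, Metric.mem_closedBall, not_le, Set.mem_ofPred_eq] at hy ⊢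
    rw [edist_comm, edist_nndist, ENNReal.coe_le_coe, ← NNReal.coe_le_coe, coe_nndist]
    exact hy.le
  obtain ⟨ρ, -, φ, hφ, hlim⟩ := (isCompact_closure_of_isTightMeasureSet ht).tendsto_subseq
    (x := ρn) fun n => subset_closure ⟨n, rfl⟩
  exact ⟨ρ, φ, hφ, hlim⟩

end Narrow

/-! ### Limits of transport plans -/

section Plans

variable {X : Type*} [MeasurableSpace X]

theorem isProbabilityMeasure_of_mem_plans {μ ν : Measure X} [IsProbabilityMeasure μ]
    {γ : Measure (X × X)} (h : γ ∈ plans μ ν) : IsProbabilityMeasure γ := by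
  have : IsProbabilityMeasure (γ.map Prod.fst) := by rw [h.1]; infer_instance
  exact Measure.isProbabilityMeasure_of_map (f := Prod.fst)

variable [MetricSpace X]

theorem exists_plan_lt {μ ν : Measure X} {c : ℝ≥0∞} (h : cost μ ν < c) :
    ∃ γ ∈ plans μ ν, ∫⁻ p, edist p.1 p.2 ∂γ < c := by
  simpa [cost, iInf_lt_iff] using h

variable [BorelSpace X]

theorem lintegral_fst_of_mem_plans {μ ν : Measure X} {γ : Measure (X × X)} (h : γ ∈ plans μ ν)
    (x₀ : X) : ∫⁻ p, edist x₀ p.1 ∂γ = ∫⁻ x, edist x₀ x ∂μ := by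
  rw [← h.1, lintegral_map (by fun_prop) (by fun_prop)]

theorem lintegral_snd_of_mem_plans {μ ν : Measure X} {γ : Measure (X × X)} (h : γ ∈ plans μ ν)
    (x₀ : X) : ∫⁻ p, edist x₀ p.2 ∂γ = ∫⁻ x, edist x₀ x ∂ν := by
  rw [← h.2, lintegral_map (by fun_prop) (by fun_prop)]

theorem lintegral_edist_le_add_cost (x₀ : X) (μ ν : Measure X) :
    ∫⁻ x, edist x₀ x ∂ν ≤ ∫⁻ x, edist x₀ x ∂μ + cost μ ν := by
  simp only [cost, ENNReal.add_iInf]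
  refine le_iInf₂ fun γ hγ => ?_
  rw [← lintegral_fst_of_mem_plans hγ x₀, ← lintegral_snd_of_mem_plans hγ x₀,
    ← lintegral_add_left (by fun_prop)]
  exact lintegral_mono fun p => edist_triangle _ _ _

variable [ProperSpace X]

/-- Plans whose marginals converge narrowly with bounded first moments have a narrow limit point,
which is a plan between the limits of the marginals. -/
theorem exists_subseq_tendsto_plans {ν : Measure X} [IsProbabilityMeasure ν]
    {μn : ℕ → ProbabilityMeasure X} {μ : ProbabilityMeasure X} (hμ : Tendsto μn atTop (𝓝 μ))
    {x₀ : X} {C : ℝ≥0∞} (hC : C ≠ ∞) (hν : ∫⁻ x, edist x₀ x ∂ν ≠ ∞)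
    (hμn : ∀ n, ∫⁻ x, edist x₀ x ∂(μn n : Measure X) ≤ C)
    {γn : ℕ → Measure (X × X)} (hγn : ∀ n, γn n ∈ plans ν (μn n : Measure X)) :
    ∃ (πn : ℕ → ProbabilityMeasure (X × X)) (π : ProbabilityMeasure (X × X)) (φ : ℕ → ℕ),
      (∀ n, (πn n : Measure (X × X)) = γn n) ∧ (π : Measure (X × X)) ∈ plans ν (μ : Measure X) ∧
      StrictMono φ ∧ Tendsto (πn ∘ φ) atTop (𝓝 π) := by
  let πn : ℕ → ProbabilityMeasure (X × X) :=
    fun n => ⟨γn n, isProbabilityMeasure_of_mem_plans (hγn n)⟩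
  obtain ⟨π, φ, hφ, hlim⟩ := exists_subseq_tendsto_of_moment_le πn (x₀, x₀)
    (ENNReal.add_ne_top.2 ⟨hν, hC⟩) fun n => by
      calc ∫⁻ p, edist (x₀, x₀) p ∂(γn n)
          ≤ ∫⁻ p, (edist x₀ p.1 + edist x₀ p.2) ∂(γn n) := by
            refine lintegral_mono fun p => ?_
            rw [Prod.edist_eq]
            exact max_le le_self_add le_add_self
        _ = ∫⁻ x, edist x₀ x ∂ν + ∫⁻ x, edist x₀ x ∂(μn n : Measure X) := by
            rw [lintegral_add_left (by fun_prop), lintegral_fst_of_mem_plans (hγn n),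
              lintegral_snd_of_mem_plans (hγn n)]
        _ ≤ _ := by gcongr; exact hμn n
  refine ⟨πn, π, φ, fun n => rfl, ⟨?_, ?_⟩, hφ, hlim⟩
  · have h1 := ProbabilityMeasure.tendsto_map_of_tendsto_of_continuous _ _ hlim continuous_fst
    let ν' : ProbabilityMeasure X := ⟨ν, inferInstance⟩
    have h2 : Tendsto (fun _ : ℕ => ν') atTop (𝓝 ν') := tendsto_const_nhds
    have h3 := tendsto_nhds_unique (h1.congr fun n => ?_) h2
    · exact congrArg Subtype.val h3
    · exact Subtype.ext (hγn (φ n)).1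
  · have h1 := ProbabilityMeasure.tendsto_map_of_tendsto_of_continuous _ _ hlim continuous_snd
    have h3 := tendsto_nhds_unique (h1.congr fun n => ?_) (hμ.comp hφ.tendsto_atTop)
    · exact congrArg Subtype.val h3
    · exact Subtype.ext (hγn (φ n)).2

/-- Near-optimal plans from a fixed measure `ν` to a narrowly convergent sequence `μn` have a limit
point `π` among the plans from `ν` to the limit of `μn`, and `π` costs at most the limit `w` of the
costs. -/
theorem exists_subseq_tendsto_near_optimal_plans {ν : Measure X} [IsProbabilityMeasure ν]
    {μn : ℕ → ProbabilityMeasure X} {μ : ProbabilityMeasure X} (hμ : Tendsto μn atTop (𝓝 μ))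
    {x₀ : X} {C : ℝ≥0∞} (hC : C ≠ ∞) (hν : ∫⁻ x, edist x₀ x ∂ν ≠ ∞)
    (hμn : ∀ n, ∫⁻ x, edist x₀ x ∂(μn n : Measure X) ≤ C) {w : ℝ≥0∞} (hw : w ≠ ∞)
    (hcost : Tendsto (fun n => cost ν (μn n : Measure X)) atTop (𝓝 w)) :
    ∃ (πn : ℕ → ProbabilityMeasure (X × X)) (π : ProbabilityMeasure (X × X)) (φ : ℕ → ℕ),
      (∀ n, (πn n : Measure (X × X)) ∈ plans ν (μn (φ n) : Measure X)) ∧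
      (π : Measure (X × X)) ∈ plans ν (μ : Measure X) ∧
      StrictMono φ ∧ Tendsto πn atTop (𝓝 π) ∧
      Tendsto (fun n => ∫⁻ p, edist p.1 p.2 ∂(πn n : Measure (X × X))) atTop (𝓝 w) ∧
      ∫⁻ p, edist p.1 p.2 ∂(π : Measure (X × X)) ≤ w := by
  -- Finitely many of the costs may be infinite; the shift by `n₀` discards them.
  obtain ⟨n₀, hn₀⟩ := eventually_atTop.1 (hcost.eventually (gt_mem_nhds hw.lt_top))
  have hex : ∀ n, ∃ γ ∈ plans ν (μn (n + n₀) : Measure X),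
      ∫⁻ p, edist p.1 p.2 ∂γ < cost ν (μn (n + n₀) : Measure X) + ((n : ℝ≥0∞) + 1)⁻¹ := by
    intro n
    apply exists_plan_lt
    exact ENNReal.lt_add_right (hn₀ _ (by omega)).ne (by simp)
  choose γn hγn hlt using hex
  obtain ⟨πn, π, φ, hπn, hπ, hφ, hlim⟩ := exists_subseq_tendsto_plans
    (hμ.comp (tendsto_add_atTop_nat n₀)) hC hν (fun n => hμn _) hγn
  have hc : Tendsto (fun n => ∫⁻ p, edist p.1 p.2 ∂(γn n)) atTop (𝓝 w) := by
    have h1 := hcost.comp (tendsto_add_atTop_nat n₀)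
    have h2 : Tendsto (fun n : ℕ => ((n : ℝ≥0∞) + 1)⁻¹) atTop (𝓝 0) := by
      have := ENNReal.tendsto_inv_nat_nhds_zero.comp (tendsto_add_atTop_nat 1)
      simpa [Function.comp_def] using this
    refine tendsto_of_tendsto_of_tendsto_of_le_of_le h1 (by simpa using h1.add h2)
      (fun n => cost_le (hγn n)) (fun n => (hlt n).le)
  have hc' : Tendsto (fun n => ∫⁻ p, edist p.1 p.2 ∂((πn ∘ φ) n : Measure (X × X))) atTop
      (𝓝 w) := by
    simpa [Function.comp_def, hπn] using hc.comp hφ.tendsto_atTop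
  refine ⟨πn ∘ φ, π, fun n => φ n + n₀, fun n => ?_, hπ, fun a b h => ?_, hlim, hc', ?_⟩
  · simpa [hπn] using hγn (φ n)
  · simpa using hφ h
  · simp only [edist_dist] at hc' ⊢
    exact lintegral_le_of_tendsto hlim (by fun_prop) (fun p => dist_nonneg) hc'

/-- If `μn` converges narrowly to `μ` and the costs from a fixed measure `ν` converge as well, no
mass escapes to infinity with a non-negligible share of the first moment: the first moments
converge along a subsequence. The triangle inequality defect `d(x₀, x) + d(x, y) - d(x₀, y)` is
nonnegative, so its integral is lower semicontinuous along near-optimal plans; this bounds the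
limit of the moments from above. -/
theorem exists_subseq_tendsto_moment {ν : Measure X} [IsProbabilityMeasure ν]
    {μn : ℕ → ProbabilityMeasure X} {μ : ProbabilityMeasure X} (hμ : Tendsto μn atTop (𝓝 μ))
    {x₀ : X} {C : ℝ≥0∞} (hC : C ≠ ∞) (hν : ∫⁻ x, edist x₀ x ∂ν ≠ ∞)
    (hμn : ∀ n, ∫⁻ x, edist x₀ x ∂(μn n : Measure X) ≤ C)
    (hw : cost ν (μ : Measure X) ≠ ∞)
    (hcost : Tendsto (fun n => cost ν (μn n : Measure X)) atTop (𝓝 (cost ν (μ : Measure X)))) :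
    ∃ φ : ℕ → ℕ, StrictMono φ ∧ Tendsto (fun n => ∫⁻ x, edist x₀ x ∂(μn (φ n) : Measure X)) atTop
      (𝓝 (∫⁻ x, edist x₀ x ∂(μ : Measure X))) := by
  obtain ⟨πn, π, φ, hπn, hπ, hφ, hlim, hc, hcπ⟩ :=
    exists_subseq_tendsto_near_optimal_plans hμ hC hν hμn hw hcost
  have hcπ' : ∫⁻ p, edist p.1 p.2 ∂(π : Measure (X × X)) = cost ν (μ : Measure X) :=
    le_antisymm hcπ (cost_le hπ)
  let f : X × X → ℝ := fun p => dist x₀ p.1 + dist p.1 p.2 - dist x₀ p.2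
  have hf : Continuous f := by fun_prop
  have hf0 : 0 ≤ f := fun p => sub_nonneg.2 (dist_triangle _ _ _)
  have hsum : ∀ {ρ : Measure X} {γ : Measure (X × X)}, γ ∈ plans ν ρ →
      ∫⁻ p, ENNReal.ofReal (f p) ∂γ + ∫⁻ x, edist x₀ x ∂ρ
        = ∫⁻ x, edist x₀ x ∂ν + ∫⁻ p, edist p.1 p.2 ∂γ := by
    intro ρ γ hγ
    rw [← lintegral_fst_of_mem_plans hγ x₀, ← lintegral_snd_of_mem_plans hγ x₀,
      ← lintegral_add_right _ (by fun_prop), ← lintegral_add_right _ (by fun_prop)]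
    refine lintegral_congr fun p => ?_
    simp only [edist_dist, f]
    rw [← ENNReal.ofReal_add (hf0 p) dist_nonneg, ← ENNReal.ofReal_add dist_nonneg dist_nonneg]
    congr 1
    ring
  obtain ⟨b, hbC, ψ, hψ, hb⟩ := (isCompact_Icc (a := (0 : ℝ≥0∞)) (b := C)).tendsto_subseq
    (x := fun n => ∫⁻ x, edist x₀ x ∂(μn (φ n) : Measure X)) fun n => ⟨zero_le, hμn _⟩
  have hbtop : b ≠ ∞ := ne_top_of_le_ne_top hC hbC.2
  have hlow : ∫⁻ x, edist x₀ x ∂(μ : Measure X) ≤ b := by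
    simp only [Function.comp_def, edist_dist] at hb ⊢
    exact lintegral_le_of_tendsto (hμ.comp (hφ.comp hψ).tendsto_atTop) (by fun_prop)
      (fun p => dist_nonneg) hb
  have hup : b ≤ ∫⁻ x, edist x₀ x ∂(μ : Measure X) := by
    have h1 : Tendsto (fun n => ∫⁻ p, ENNReal.ofReal (f p) ∂(πn (ψ n) : Measure (X × X))) atTop
        (𝓝 (∫⁻ x, edist x₀ x ∂ν + cost ν (μ : Measure X) - b)) := by
      refine Tendsto.congr (fun n => ?_) (ENNReal.Tendsto.sub
        ((tendsto_const_nhds (x := ∫⁻ x, edist x₀ x ∂ν)).add (hc.comp hψ.tendsto_atTop)) hb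
        (Or.inr hbtop))
      have := hsum (hπn (ψ n))
      simp only [Function.comp_apply]
      rw [← this]
      exact ENNReal.add_sub_cancel_right (ne_top_of_le_ne_top hC (hμn _))
    have h2 := lintegral_le_of_tendsto (hlim.comp hψ.tendsto_atTop) hf hf0 h1
    have h3 := hsum hπ
    have hAtop : ∫⁻ x, edist x₀ x ∂ν + cost ν (μ : Measure X) ≠ ∞ := ENNReal.add_ne_top.2 ⟨hν, hw⟩
    have hb' : b ≤ ∫⁻ x, edist x₀ x ∂ν + cost ν (μ : Measure X) := by
      refine le_of_tendsto_of_tendsto' hb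
        ((tendsto_const_nhds (x := ∫⁻ x, edist x₀ x ∂ν)).add (hc.comp hψ.tendsto_atTop)) fun n => ?_
      simp only [Function.comp_apply]
      rw [← hsum (hπn (ψ n))]
      exact le_add_self
    rw [hcπ'] at h3
    have h4 : b + ∫⁻ p, ENNReal.ofReal (f p) ∂(π : Measure (X × X)) ≤
        ∫⁻ x, edist x₀ x ∂(μ : Measure X) + ∫⁻ p, ENNReal.ofReal (f p) ∂(π : Measure (X × X)) := by
      rw [add_comm _ (∫⁻ p, ENNReal.ofReal (f p) ∂(π : Measure (X × X))),
        add_comm _ (∫⁻ p, ENNReal.ofReal (f p) ∂(π : Measure (X × X))), h3]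
      calc _ ≤ (∫⁻ x, edist x₀ x ∂ν + cost ν (μ : Measure X) - b) + b := by gcongr
        _ = _ := tsub_add_cancel_of_le hb'
    refine (ENNReal.add_le_add_iff_right ?_).1 h4
    exact ne_top_of_le_ne_top hAtop (h2.trans tsub_le_self)
  refine ⟨φ ∘ ψ, hφ.comp hψ, ?_⟩
  rw [le_antisymm hlow hup]
  exact hb

end Plans

/-! ### Convergence of measures and of first moments implies convergence of costs -/

section Partition

variable {X : Type*} [MetricSpace X] [ProperSpace X]

/-- Fine partitions of unity near `x₀`: the functions indexed by `some j` live near their base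
points and have bounded support, the remaining one vanishes on a large ball. -/
theorem exists_partition (x₀ : X) (R : ℝ) {ε : ℝ} (hε : 0 < ε) :
    ∃ (t : Finset X) (ψ : Option t → C(X, ℝ≥0)) (c : Option t → X), (∀ x, ∑ j, ψ j x = 1) ∧
      c none = x₀ ∧ (∀ j x, ψ (some j) x ≠ 0 → dist x (c (some j)) < ε ∧ dist x x₀ < R + ε) ∧
      ∀ x, ψ none x ≠ 0 → R < dist x x₀ := by
  obtain ⟨s, hsR, hs, hcov⟩ :=
    (isCompact_closedBall x₀ R).finite_cover_balls (e := ε) hε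
  let t := hs.toFinset
  let U : Option t → Set X := fun j => j.elim (Metric.closedBall x₀ R)ᶜ fun y => Metric.ball y ε
  obtain ⟨f, hf⟩ := PartitionOfUnity.exists_isSubordinate isClosed_univ U
    (by
      rintro (_ | y)
      · exact Metric.isClosed_closedBall.isOpen_compl
      · exact Metric.isOpen_ball)
    (by
      intro x _
      by_cases hx : x ∈ Metric.closedBall x₀ R
      · obtain ⟨y, hy, hxy⟩ := Set.mem_iUnion₂.1 (hcov hx)
        exact Set.mem_iUnion.2 ⟨some ⟨y, hs.mem_toFinset.2 hy⟩, hxy⟩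
      · exact Set.mem_iUnion.2 ⟨none, hx⟩)
  have hsupp : ∀ j x, (f j x).toNNReal ≠ 0 → x ∈ U j := fun j x hx =>
    hf j (subset_tsupport _ fun h => hx (by simp [h]))
  refine ⟨t, fun j => ⟨fun x => (f j x).toNNReal, by fun_prop⟩, fun j => j.elim x₀ fun y => y,
    fun x => ?_, rfl, fun j x hx => ?_, fun x hx => ?_⟩
  · have h1 := f.sum_eq_one (Set.mem_univ x)
    rw [finsum_eq_sum_of_fintype] at h1
    simp only [ContinuousMap.coe_mk]
    rw [← Real.toNNReal_sum_of_nonneg fun j _ => f.nonneg j x, h1, Real.toNNReal_one]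
  · have h1 : dist x j < ε := hsupp _ x hx
    refine ⟨h1, ?_⟩
    have h2 : dist (j : X) x₀ ≤ R := hsR (hs.mem_toFinset.1 j.2)
    linarith [dist_triangle x j x₀]
  · simpa [U] using hsupp none x hx

end Partition

section Discrete

variable {X : Type*} [MetricSpace X] [MeasurableSpace X] [BorelSpace X] [ProperSpace X]

/-- The normalized product of two measures of equal mass is a plan between them. -/
theorem smul_prod_mem_plans {μ ν : Measure X} [IsFiniteMeasure μ] [IsFiniteMeasure ν]
    (h : μ Set.univ = ν Set.univ) : (μ Set.univ)⁻¹ • μ.prod ν ∈ plans μ ν := by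
  have key : ∀ ρ : Measure X, ρ Set.univ = μ Set.univ →
      (μ Set.univ)⁻¹ • (μ Set.univ • ρ) = ρ := by
    intro ρ hρ
    rcases eq_or_ne (μ Set.univ) 0 with h0 | h0
    · rw [h0, Measure.measure_univ_eq_zero] at hρ
      simp [hρ]
    · rw [smul_smul, ENNReal.inv_mul_cancel h0 (measure_ne_top _ _), one_smul]
  constructor
  · rw [Measure.map_smul, Measure.map_fst_prod, ← h]
    exact key μ rfl
  · rw [Measure.map_smul, Measure.map_snd_prod]
    exact key ν h.symm

/-- Mass common to two measures need not move; the excess parts can be transported through `x₀`. -/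
theorem cost_add_left_le (x₀ : X) (ρ μ ν : Measure X) [IsFiniteMeasure μ] [IsFiniteMeasure ν]
    (h : μ Set.univ = ν Set.univ) :
    cost (ρ + μ) (ρ + ν) ≤ ∫⁻ x, edist x₀ x ∂μ + ∫⁻ x, edist x₀ x ∂ν := by
  have hγ := smul_prod_mem_plans h
  have hp : ρ.map (fun x => (x, x)) + (μ Set.univ)⁻¹ • μ.prod ν ∈ plans (ρ + μ) (ρ + ν) := by
    constructor
    · rw [Measure.map_add _ _ (by fun_prop), hγ.1, Measure.map_map (by fun_prop) (by fun_prop)]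
      exact congrArg (· + μ) Measure.map_id
    · rw [Measure.map_add _ _ (by fun_prop), hγ.2, Measure.map_map (by fun_prop) (by fun_prop)]
      exact congrArg (· + ν) Measure.map_id
  refine (cost_le hp).trans ?_
  rw [lintegral_add_measure, lintegral_map (by fun_prop) (by fun_prop),
    ← lintegral_fst_of_mem_plans hγ x₀, ← lintegral_snd_of_mem_plans hγ x₀,
    ← lintegral_add_left (by fun_prop)]
  simp only [edist_self, lintegral_zero, zero_add]
  refine lintegral_mono fun p => ?_
  rw [edist_comm x₀ p.1]
  exact edist_triangle _ _ _

variable {J : Type*} [Fintype J]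

/-- The cost between two probability measures carried by the same finitely many points is
controlled by the differences of their weights. -/
theorem cost_sum_dirac_le (x₀ : X) (c : J → X) {a b : J → ℝ≥0∞} (ha : ∑ j, a j = 1)
    (hb : ∑ j, b j = 1) :
    cost (∑ j, a j • Measure.dirac (c j)) (∑ j, b j • Measure.dirac (c j)) ≤
      ∑ j, ((a j - b j) + (b j - a j)) * edist x₀ (c j) := by
  have hle : ∀ {a b : J → ℝ≥0∞}, ∑ j, a j = 1 → ∑ j, (a j - b j) ≤ 1 := fun h =>
    h ▸ Finset.sum_le_sum fun j _ => tsub_le_self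
  have split : ∀ a b : J → ℝ≥0∞, ∑ j, a j • Measure.dirac (c j) =
      ∑ j, min (a j) (b j) • Measure.dirac (c j) + ∑ j, (a j - b j) • Measure.dirac (c j) := by
    intro a b
    rw [← Finset.sum_add_distrib]
    refine Finset.sum_congr rfl fun j _ => ?_
    rw [← add_smul, add_comm, tsub_add_min]
  have mass : ∀ a : J → ℝ≥0∞, (∑ j, a j • Measure.dirac (c j)) Set.univ = ∑ j, a j := by
    intro a
    simp
  have fin : ∀ {a b : J → ℝ≥0∞}, ∑ j, a j = 1 →
      IsFiniteMeasure (∑ j, (a j - b j) • Measure.dirac (c j)) := fun h =>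
    ⟨by rw [mass]; exact (hle h).trans_lt ENNReal.one_lt_top⟩
  have := fin (b := b) ha
  have := fin (b := a) hb
  have hmass : ∑ j, (a j - b j) = ∑ j, (b j - a j) := by
    have h1 : ∑ j, (a j - b j) + ∑ j, min (a j) (b j) = 1 := by
      rw [← Finset.sum_add_distrib, ← ha]
      exact Finset.sum_congr rfl fun j _ => tsub_add_min
    have h2 : ∑ j, (b j - a j) + ∑ j, min (a j) (b j) = 1 := by
      rw [← Finset.sum_add_distrib, ← hb]
      exact Finset.sum_congr rfl fun j _ => by rw [min_comm, tsub_add_min]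
    refine (ENNReal.add_left_inj ?_).1 (h1.trans h2.symm)
    exact ne_top_of_le_ne_top ENNReal.one_ne_top (h1 ▸ le_add_self)
  rw [split a b, split b a]
  simp only [min_comm (b _)]
  refine (cost_add_left_le x₀ _ _ _ (by rw [mass, mass, hmass])).trans_eq ?_
  simp only [lintegral_finsetSum_measure, lintegral_smul_measure, lintegral_dirac, smul_eq_mul,
    ← Finset.sum_add_distrib, add_mul]

/-- A continuous partition of unity `ψ` with base points `c` discretizes a probability measure:
the mass at `x` is sent to the points `c j` with weights `ψ j x`. -/
theorem cost_discretization_le {μ : Measure X} [IsProbabilityMeasure μ] {ψ : J → C(X, ℝ≥0)}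
    (hψ : ∀ x, ∑ j, ψ j x = 1) (c : J → X) :
    cost μ (∑ j, (∫⁻ x, ψ j x ∂μ) • Measure.dirac (c j)) ≤
      ∫⁻ x, ∑ j, (ψ j x : ℝ≥0∞) * edist x (c j) ∂μ := by
  let γ : Measure (X × X) :=
    ∑ j, (μ.withDensity fun x => (ψ j x : ℝ≥0∞)).map fun x => (x, c j)
  have hp : γ ∈ plans μ (∑ j, (∫⁻ x, ψ j x ∂μ) • Measure.dirac (c j)) := by
    constructor
    · ext s hs
      rw [Measure.map_apply (by fun_prop) hs]
      simp only [γ, Measure.finsetSum_apply]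
      calc _ = ∑ j, ∫⁻ x in s, ψ j x ∂μ := by
            refine Finset.sum_congr rfl fun j _ => ?_
            rw [Measure.map_apply (by fun_prop) (hs.preimage (by fun_prop)),
              ← withDensity_apply _ hs]
            rfl
        _ = ∫⁻ x in s, ∑ j, (ψ j x : ℝ≥0∞) ∂μ :=
            (lintegral_finsetSum _ fun j _ => by fun_prop).symm
        _ = μ s := by
            simp only [← ENNReal.ofNNReal_finsetSum, hψ, ENNReal.coe_one, lintegral_one,
              Measure.restrict_apply_univ]
    · ext s hs
      rw [Measure.map_apply (by fun_prop) hs]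
      simp only [γ, Measure.finsetSum_apply]
      refine Finset.sum_congr rfl fun j _ => ?_
      rw [Measure.map_apply (by fun_prop) (hs.preimage (by fun_prop)), Measure.smul_apply,
        Measure.dirac_apply' _ hs]
      by_cases hc : c j ∈ s <;> simp [hc, Set.preimage, withDensity_apply]
  refine (cost_le hp).trans_eq ?_
  rw [lintegral_finsetSum_measure, lintegral_finsetSum _ fun j _ => by fun_prop]
  refine Finset.sum_congr rfl fun j _ => ?_
  rw [lintegral_map (by fun_prop) (by fun_prop),
    lintegral_withDensity_eq_lintegral_mul _ (by fun_prop) (by fun_prop)]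
  rfl

end Discrete

section Convergence

variable {X : Type*} [MetricSpace X] [MeasurableSpace X] [BorelSpace X]

/-- The part of the first moment outside of a large ball is small. -/
theorem exists_lintegral_far_le {μ : Measure X} {x₀ : X} (h : ∫⁻ x, edist x₀ x ∂μ ≠ ∞)
    {ε : ℝ≥0∞} (hε : 0 < ε) :
    ∃ R : ℝ, ∫⁻ x in {x | R < dist x x₀}, edist x₀ x ∂μ ≤ ε := by
  have h1 : Tendsto (fun n : ℕ => ∫⁻ x, {x | (n : ℝ) < dist x x₀}.indicator (edist x₀) x ∂μ) atTop
      (𝓝 (∫⁻ _, 0 ∂μ)) := by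
    have hm : ∀ n : ℕ, MeasurableSet {x | (n : ℝ) < dist x x₀} := fun n =>
      measurableSet_lt measurable_const (by fun_prop)
    refine tendsto_lintegral_of_dominated_convergence (edist x₀)
      (fun n => (show Measurable (edist x₀) by fun_prop).indicator (hm n))
      (fun n => ae_of_all _ fun x => Set.indicator_le_self _ _ _) h (ae_of_all _ fun x => ?_)
    refine tendsto_const_nhds.congr' ?_
    filter_upwards [tendsto_natCast_atTop_atTop.eventually (eventually_ge_atTop (dist x x₀))]
      with n hn
    rw [Set.indicator_of_notMem]
    simpa using hn
  rw [lintegral_zero] at h1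
  obtain ⟨n, hn⟩ := (h1.eventually (gt_mem_nhds hε)).exists
  refine ⟨n, ?_⟩
  rw [← lintegral_indicator (measurableSet_lt measurable_const (by fun_prop))]
  exact hn.le

variable [ProperSpace X]

/-- Narrow convergence together with convergence of the first moments implies convergence for the
transport cost. Both measures are discretized by the same continuous partition of unity, whose
weights converge. -/
theorem tendsto_cost_zero {μn : ℕ → ProbabilityMeasure X} {μ : ProbabilityMeasure X}
    (hμ : Tendsto μn atTop (𝓝 μ)) {x₀ : X} (hfin : ∫⁻ x, edist x₀ x ∂(μ : Measure X) ≠ ∞)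
    (hmom : Tendsto (fun n => ∫⁻ x, edist x₀ x ∂(μn n : Measure X)) atTop
      (𝓝 (∫⁻ x, edist x₀ x ∂(μ : Measure X)))) :
    Tendsto (fun n => cost (μn n : Measure X) (μ : Measure X)) atTop (𝓝 0) := by
  have main : ∀ ε : ℝ≥0, 0 < ε →
      ∀ᶠ n in atTop, cost (μn n : Measure X) (μ : Measure X) ≤ 5 * (ε : ℝ≥0∞) := by
    intro ε hε
    have hε' : (0 : ℝ≥0∞) < ε := ENNReal.coe_pos.2 hε
    obtain ⟨R, hR⟩ := exists_lintegral_far_le hfin hε'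
    obtain ⟨t, ψ, c, hψ, hc, hnear, hfar⟩ := exists_partition x₀ R (ε := ε) (by exact_mod_cast hε)
    have hψ1 : ∀ j x, ψ j x ≤ 1 := fun j x =>
      hψ x ▸ Finset.single_le_sum (f := fun j => ψ j x) (fun _ _ => zero_le) (Finset.mem_univ j)
    -- The first moment splits into a far part `H` and a near part `K`; the near part is the
    -- integral of a bounded continuous function.
    let H : Measure X → ℝ≥0∞ := fun m => ∫⁻ x, (ψ none x : ℝ≥0∞) * edist x₀ x ∂m
    let k : X → ℝ≥0 := fun x => (∑ j : t, ψ (some j) x) * nndist x₀ x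
    have hsum' : ∀ x, ψ none x + ∑ j : t, ψ (some j) x = 1 := fun x => by
      rw [← hψ x, Fintype.sum_option]
    have hsum1 : ∀ x, ∑ j : t, ψ (some j) x ≤ 1 := fun x => hsum' x ▸ le_add_self
    have hk : Continuous k := by fun_prop
    have hkC : ∀ x, k x ≤ (R + ε).toNNReal := by
      intro x
      by_cases hx : ∃ j : t, ψ (some j) x ≠ 0
      · obtain ⟨j, hj⟩ := hx
        refine (mul_le_of_le_one_left zero_le (hsum1 x)).trans ?_
        refine NNReal.le_toNNReal_of_coe_le ?_
        rw [coe_nndist, dist_comm]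
        exact (hnear j x hj).2.le
      · push Not at hx
        simp [k, hx]
    have hsplit : ∀ m : Measure X, ∫⁻ x, edist x₀ x ∂m = H m + ∫⁻ x, k x ∂m := by
      intro m
      rw [← lintegral_add_left (by fun_prop)]
      refine lintegral_congr fun x => ?_
      rw [edist_nndist, ← ENNReal.coe_mul, ← ENNReal.coe_add, ← add_mul, hsum', one_mul]
    have hkfin : ∀ m : ProbabilityMeasure X, ∫⁻ x, k x ∂(m : Measure X) ≠ ∞ := by
      intro m
      refine ne_top_of_le_ne_top ?_ (lintegral_mono fun x => ENNReal.coe_le_coe.2 (hkC x))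
      simp
    have hHlim : Tendsto (fun n => H (μn n)) atTop (𝓝 (H μ)) := by
      have hH : ∀ m : ProbabilityMeasure X,
          H m = ∫⁻ x, edist x₀ x ∂(m : Measure X) - ∫⁻ x, k x ∂(m : Measure X) := fun m => by
        rw [hsplit, ENNReal.add_sub_cancel_right (hkfin m)]
      simp only [hH]
      exact ENNReal.Tendsto.sub hmom (tendsto_lintegral_of_le hμ hk hkC) (Or.inl hfin)
    have hHμ : H μ ≤ ε := by
      refine le_trans ?_ hR
      rw [← lintegral_indicator (measurableSet_lt measurable_const (by fun_prop))]
      refine lintegral_mono fun x => ?_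
      by_cases hx : ψ none x = 0
      · simp [hx]
      · rw [Set.indicator_of_mem (s := {x | R < dist x x₀}) (hfar x hx)]
        exact mul_le_of_le_one_left zero_le (ENNReal.coe_le_one_iff.2 (hψ1 _ _))
    have hdisc : ∀ m : ProbabilityMeasure X,
        cost (m : Measure X) (∑ j, (∫⁻ x, ψ j x ∂(m : Measure X)) • Measure.dirac (c j)) ≤
          ε + H m := by
      intro m
      have h1 : ∫⁻ _, (ε : ℝ≥0∞) ∂(m : Measure X) = ε := by simp
      refine (cost_discretization_le hψ c).trans ?_
      rw [← h1, ← lintegral_add_left (by fun_prop)]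
      refine lintegral_mono fun x => ?_
      rw [Fintype.sum_option, hc, edist_comm x x₀, add_comm]
      gcongr
      calc ∑ j : t, (ψ (some j) x : ℝ≥0∞) * edist x (c (some j))
          ≤ ∑ j : t, (ψ (some j) x : ℝ≥0∞) * ε := by
            refine Finset.sum_le_sum fun j _ => ?_
            by_cases hx : ψ (some j) x = 0
            · simp [hx]
            · gcongr
              rw [edist_nndist, ENNReal.coe_le_coe]
              exact (hnear j x hx).1.le
        _ ≤ ε := by
            rw [← Finset.sum_mul]
            refine mul_le_of_le_one_left zero_le ?_
            exact_mod_cast hsum1 x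
    have hsum : ∀ m : ProbabilityMeasure X, ∑ j, ∫⁻ x, ψ j x ∂(m : Measure X) = 1 := by
      intro m
      rw [← lintegral_finsetSum _ fun j _ => by fun_prop]
      simp [← ENNReal.ofNNReal_finsetSum, hψ]
    let S : ℕ → ℝ≥0∞ := fun n =>
      ∑ j, ((∫⁻ x, ψ j x ∂(μn n : Measure X) - ∫⁻ x, ψ j x ∂(μ : Measure X)) +
        (∫⁻ x, ψ j x ∂(μ : Measure X) - ∫⁻ x, ψ j x ∂(μn n : Measure X))) * edist x₀ (c j)
    have hS : Tendsto S atTop (𝓝 0) := by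
      rw [← Finset.sum_const_zero (s := (Finset.univ : Finset (Option t)))]
      refine tendsto_finsetSum _ fun j _ => ?_
      have hw := tendsto_lintegral_of_le hμ (ψ j).continuous (hψ1 j)
      have hwfin : ∫⁻ x, ψ j x ∂(μ : Measure X) ≠ ∞ := by
        refine ne_top_of_le_ne_top ENNReal.one_ne_top ?_
        rw [← hsum μ]
        exact Finset.single_le_sum (f := fun j => ∫⁻ x, ψ j x ∂(μ : Measure X))
          (fun _ _ => zero_le) (Finset.mem_univ j)
      have hconst := tendsto_const_nhds (x := ∫⁻ x, ψ j x ∂(μ : Measure X)) (f := atTop (α := ℕ))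
      have h1 := ENNReal.Tendsto.mul_const (b := edist x₀ (c j))
        ((ENNReal.Tendsto.sub hw hconst (Or.inr hwfin)).add
          (ENNReal.Tendsto.sub hconst hw (Or.inr hwfin))) (Or.inr (edist_ne_top _ _))
      simpa using h1
    have hbound : ∀ n, cost (μn n : Measure X) (μ : Measure X) ≤
        (ε + H (μn n)) + (S n + (ε + H μ)) := by
      intro n
      have : IsProbabilityMeasure
          (∑ j, (∫⁻ x, ψ j x ∂(μn n : Measure X)) • Measure.dirac (c j)) :=
        ⟨by simpa using hsum (μn n)⟩
      refine (cost_triangle _ (∑ j, (∫⁻ x, ψ j x ∂(μn n : Measure X)) • Measure.dirac (c j))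
        _).trans (add_le_add (hdisc _) ?_)
      refine (cost_triangle _ (∑ j, (∫⁻ x, ψ j x ∂(μ : Measure X)) • Measure.dirac (c j))
        _).trans (add_le_add (cost_sum_dirac_le x₀ c (hsum _) (hsum _)) ?_)
      exact (cost_comm_le _ _).trans (hdisc μ)
    have hlim : Tendsto (fun n => (ε + H (μn n)) + (S n + (ε + H μ))) atTop
        (𝓝 ((ε + H μ) + (0 + (ε + H μ)))) :=
      (tendsto_const_nhds.add hHlim).add (hS.add tendsto_const_nhds)
    -- Each of the two discretizations costs at most `2 * ε` in the limit.
    have hlt : (ε + H μ) + (0 + (ε + H μ)) < 5 * (ε : ℝ≥0∞) := by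
      calc (ε + H μ) + (0 + (ε + H μ)) ≤ (ε + ε) + (0 + (ε + ε)) := by gcongr
        _ = ((4 * ε : ℝ≥0) : ℝ≥0∞) := by push_cast; ring
        _ < ((5 * ε : ℝ≥0) : ℝ≥0∞) := by
          rw [ENNReal.coe_lt_coe]
          gcongr
          norm_num
        _ = _ := by push_cast; rfl
    filter_upwards [hlim.eventually (gt_mem_nhds hlt)] with n hn
    exact (hbound n).trans hn.le
  rw [ENNReal.tendsto_nhds_zero]
  intro ε hε
  obtain ⟨δ, hδ0, hδ⟩ := ENNReal.lt_iff_exists_nnreal_btwn.1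
    (ENNReal.div_pos hε.ne' (ENNReal.ofNat_ne_top (n := 5)))
  filter_upwards [main δ (ENNReal.coe_pos.1 hδ0)] with n hn
  calc cost (μn n : Measure X) (μ : Measure X) ≤ 5 * (δ : ℝ≥0∞) := hn
    _ ≤ 5 * (ε / 5) := by gcongr
    _ = ε := ENNReal.mul_div_cancel (by simp) (by simp)

end Convergence

/-! ### Stability of medians -/

section Medians

variable {X : Type*} [MetricSpace X] [MeasurableSpace X]

/-- The element of `ProbabilityMeasure X` underlying an element of `P1 X`. It carries the topology
of narrow convergence, whereas `P1 X` carries that of `W1`. -/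
def P1.toProbabilityMeasure (μ : P1 X) : ProbabilityMeasure X :=
  ⟨μ.toMeasure, μ.isProbabilityMeasure⟩

theorem P1.lintegral_edist_ne_top (μ : P1 X) (x₀ : X) :
    ∫⁻ x, edist x₀ x ∂μ.toMeasure ≠ ∞ := by
  have := μ.isProbabilityMeasure
  obtain ⟨a, ha⟩ := μ.finite_moment
  have h1 : ∫⁻ x, edist a x ∂μ.toMeasure ≠ ∞ := by
    simpa [edist_dist] using ha.lintegral_lt_top.ne
  refine ne_top_of_le_ne_top ?_ (lintegral_mono fun x => edist_triangle x₀ a x)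
  rw [lintegral_add_left (by fun_prop)]
  simp [h1, edist_ne_top]

variable [BorelSpace X]

theorem exists_P1_of_lintegral_edist_ne_top {μ : ProbabilityMeasure X} {x₀ : X}
    (h : ∫⁻ x, edist x₀ x ∂(μ : Measure X) ≠ ∞) :
    ∃ μ' : P1 X, μ'.toProbabilityMeasure = μ := by
  refine ⟨⟨μ, inferInstance, x₀, Continuous.aestronglyMeasurable (by fun_prop), ?_⟩, rfl⟩
  rw [hasFiniteIntegral_iff_ofReal (ae_of_all _ fun x => dist_nonneg)]
  simpa [edist_dist, lt_top_iff_ne_top] using h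

variable [ProperSpace X]

theorem cost_eq_ofReal_dist (μ ν : P1 X) :
    cost μ.toMeasure ν.toMeasure = ENNReal.ofReal (dist μ ν) :=
  (ENNReal.ofReal_toReal (cost_ne_top μ ν)).symm

variable {N : ℕ}

theorem continuous_dispersion : Continuous
    fun p : (stdSimplex ℝ (Fin N) × (Fin N → P1 X)) × P1 X => dispersion p.1.1 p.1.2 p.2 := by
  unfold dispersion
  refine continuous_finsetSum _ fun i _ => Continuous.mul
    ((continuous_apply i).comp (continuous_subtype_val.comp (continuous_fst.comp continuous_fst))) ?_
  exact Continuous.dist (f := fun p : (stdSimplex ℝ (Fin N) × (Fin N → P1 X)) × P1 X => p.1.2 i)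
    (by fun_prop) continuous_snd

/-- By minimality, the distance from a median to any `ρ` is at most twice the weighted average
distance from the sample to `ρ`. -/
theorem dist_le_two_mul_dispersion {lam : stdSimplex ℝ (Fin N)} {ν : Fin N → P1 X} {μ : P1 X}
    (hμ : μ ∈ Med lam ν) (ρ : P1 X) : dist ρ μ ≤ 2 * dispersion lam ν ρ := by
  calc dist ρ μ = ∑ i, lam.1 i * dist ρ μ := by rw [← Finset.sum_mul, lam.2.2, one_mul]
    _ ≤ ∑ i, (lam.1 i * W1 (ν i) ρ + lam.1 i * W1 (ν i) μ) := by
      refine Finset.sum_le_sum fun i _ => ?_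
      rw [← mul_add]
      exact mul_le_mul_of_nonneg_left (dist_triangle_left _ _ _) (lam.2.1 i)
    _ = dispersion lam ν ρ + dispersion lam ν μ := Finset.sum_add_distrib
    _ ≤ 2 * dispersion lam ν ρ := by linarith [hμ ρ]

/-- A narrow limit point at finite distance: a bounded sequence in `P1 X` has a subsequence that
converges narrowly in `P1 X`, along which the distances to given points converge to limits that
dominate the distances from the narrow limit. -/
theorem exists_subseq_tendsto_of_dist_le {μₙ : ℕ → P1 X} {B : ℝ} (ν : Fin N → P1 X) (i₀ : Fin N)
    (hB : ∀ n, dist (ν i₀) (μₙ n) ≤ B) :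
    ∃ (μ : P1 X) (w : Fin N → ℝ) (φ : ℕ → ℕ), StrictMono φ ∧
      Tendsto (fun n => (μₙ (φ n)).toProbabilityMeasure) atTop (𝓝 μ.toProbabilityMeasure) ∧
      (∀ i, Tendsto (fun n => dist (ν i) (μₙ (φ n))) atTop (𝓝 (w i))) ∧
      ∀ i, dist (ν i) μ ≤ w i := by
  obtain ⟨x₀, -⟩ := (ν i₀).finite_moment
  let C : ℝ≥0∞ := ∫⁻ x, edist x₀ x ∂(ν i₀).toMeasure + ENNReal.ofReal B
  have hC : C ≠ ∞ := ENNReal.add_ne_top.2 ⟨(ν i₀).lintegral_edist_ne_top x₀, ENNReal.ofReal_ne_top⟩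
  have hmom : ∀ n, ∫⁻ x, edist x₀ x ∂(μₙ n).toMeasure ≤ C := fun n => by
    refine (lintegral_edist_le_add_cost x₀ (ν i₀).toMeasure _).trans ?_
    rw [cost_eq_ofReal_dist]
    exact add_le_add_right (ENNReal.ofReal_le_ofReal (hB n)) _
  obtain ⟨μ', φ, hφ, hμ'⟩ := exists_subseq_tendsto_of_moment_le
    (fun n => (μₙ n).toProbabilityMeasure) x₀ hC hmom
  obtain ⟨w, hw, ψ, hψ, hlim⟩ := (isCompact_univ_pi fun i =>
      isCompact_Icc (a := (0 : ℝ)) (b := dist (ν i) (ν i₀) + B)).tendsto_subseq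
    (x := fun n i => dist (ν i) (μₙ (φ n)))
    (fun n i _ => ⟨dist_nonneg, (dist_triangle _ (ν i₀) _).trans (by gcongr; exact hB _)⟩)
  rw [tendsto_pi_nhds] at hlim
  have hnarrow := hμ'.comp hψ.tendsto_atTop
  have hcost : ∀ i, cost (ν i).toMeasure (μ' : Measure X) ≤ ENNReal.ofReal (w i) := by
    intro i
    have := (ν i).isProbabilityMeasure
    obtain ⟨-, π, -, -, hπ, -, -, -, hle⟩ := exists_subseq_tendsto_near_optimal_plans hnarrow hC
      ((ν i).lintegral_edist_ne_top x₀) (fun n => hmom _) (w := ENNReal.ofReal (w i))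
      ENNReal.ofReal_ne_top (by
        refine (ENNReal.tendsto_ofReal (hlim i)).congr fun n => ?_
        exact (cost_eq_ofReal_dist _ _).symm)
    exact (cost_le hπ).trans hle
  obtain ⟨μ, rfl⟩ := exists_P1_of_lintegral_edist_ne_top (μ := μ') (x₀ := x₀) (by
    refine ne_top_of_le_ne_top ?_ (lintegral_edist_le_add_cost x₀ (ν i₀).toMeasure _)
    exact ENNReal.add_ne_top.2 ⟨(ν i₀).lintegral_edist_ne_top x₀,
      ne_top_of_le_ne_top ENNReal.ofReal_ne_top (hcost i₀)⟩)
  exact ⟨μ, w, φ ∘ ψ, hφ.comp hψ, hnarrow, hlim, fun i =>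
    ENNReal.toReal_le_of_le_ofReal (hw i trivial).1 (hcost i)⟩

/-- Narrow convergence together with convergence of the distances to one point `ν` implies
convergence in `P1 X` along a subsequence. -/
theorem exists_subseq_tendsto_of_tendsto_dist {μₙ : ℕ → P1 X} {μ : P1 X} (ν : P1 X)
    (hnarrow : Tendsto (fun n => (μₙ n).toProbabilityMeasure) atTop (𝓝 μ.toProbabilityMeasure))
    (hdist : Tendsto (fun n => dist ν (μₙ n)) atTop (𝓝 (dist ν μ))) :
    ∃ φ : ℕ → ℕ, StrictMono φ ∧ Tendsto (μₙ ∘ φ) atTop (𝓝 μ) := by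
  have := ν.isProbabilityMeasure
  obtain ⟨x₀, -⟩ := ν.finite_moment
  obtain ⟨B, hB⟩ := hdist.bddAbove_range
  obtain ⟨φ, hφ, hmom⟩ := exists_subseq_tendsto_moment (ν := ν.toMeasure) hnarrow (x₀ := x₀)
    (C := ∫⁻ x, edist x₀ x ∂ν.toMeasure + ENNReal.ofReal B)
    (ENNReal.add_ne_top.2 ⟨ν.lintegral_edist_ne_top x₀, ENNReal.ofReal_ne_top⟩)
    (ν.lintegral_edist_ne_top x₀)
    (fun n => by
      refine (lintegral_edist_le_add_cost x₀ ν.toMeasure _).trans ?_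
      refine add_le_add_right ?_ _
      exact (cost_eq_ofReal_dist ν (μₙ n)).trans_le (ENNReal.ofReal_le_ofReal (hB ⟨n, rfl⟩)))
    (cost_ne_top ν μ)
    (by
      have h1 := ENNReal.tendsto_ofReal hdist
      simp only [← cost_eq_ofReal_dist] at h1
      exact h1)
  refine ⟨φ, hφ, ?_⟩
  have h1 := tendsto_cost_zero (hnarrow.comp hφ.tendsto_atTop) (μ.lintegral_edist_ne_top x₀) hmom
  rw [tendsto_iff_dist_tendsto_zero]
  exact (ENNReal.tendsto_toReal ENNReal.zero_ne_top).comp h1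

/-- Sequential stability of medians. The dispersions of the medians converge to the minimal
dispersion, which forces the distance to every sample point of positive weight to converge. -/
theorem exists_subseq_tendsto_of_mem_Med {lam : stdSimplex ℝ (Fin N)} {ν : Fin N → P1 X}
    {lamₙ : ℕ → stdSimplex ℝ (Fin N)} {νₙ : ℕ → Fin N → P1 X} {μₙ : ℕ → P1 X}
    (hlam : Tendsto lamₙ atTop (𝓝 lam)) (hν : Tendsto νₙ atTop (𝓝 ν))
    (hμ : ∀ n, μₙ n ∈ Med (lamₙ n) (νₙ n)) :
    ∃ μ ∈ Med lam ν, ∃ φ : ℕ → ℕ, StrictMono φ ∧ Tendsto (μₙ ∘ φ) atTop (𝓝 μ) := by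
  -- Only for a positive weight is the limit of the distances to `ν i` forced to be optimal.
  obtain ⟨i₀, -, hi₀⟩ : ∃ i ∈ Finset.univ, 0 < lam.1 i :=
    Finset.exists_lt_of_sum_lt (f := fun _ => 0) (by rw [lam.2.2]; simp)
  have hdisp : ∀ ρ, Tendsto (fun n => dispersion (lamₙ n) (νₙ n) ρ) atTop
      (𝓝 (dispersion lam ν ρ)) := fun ρ =>
    (continuous_dispersion.tendsto ((lam, ν), ρ)).comp
      ((hlam.prodMk_nhds hν).prodMk_nhds tendsto_const_nhds)
  obtain ⟨B, hB⟩ := (hdisp (ν i₀)).bddAbove_range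
  obtain ⟨μ, w, φ, hφ, hnarrow, hw, hle⟩ := exists_subseq_tendsto_of_dist_le (B := 2 * B) ν i₀
    fun n => (dist_le_two_mul_dispersion (hμ n) _).trans (by gcongr; exact hB ⟨n, rfl⟩)
  have hlim : Tendsto (fun n => dispersion (lamₙ (φ n)) (νₙ (φ n)) (μₙ (φ n))) atTop
      (𝓝 (∑ i, lam.1 i * w i)) := by
    refine tendsto_finsetSum _ fun i _ => Tendsto.mul ?_ ?_
    · exact (tendsto_pi_nhds.1 ((continuous_subtype_val.tendsto lam).comp hlam) i).comp
        hφ.tendsto_atTop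
    · -- The distances to `νₙ i` and to `ν i` have the same limit.
      have h1 : Tendsto (fun n => dist (νₙ (φ n) i) (ν i)) atTop (𝓝 0) :=
        (tendsto_iff_dist_tendsto_zero.1 (tendsto_pi_nhds.1 hν i)).comp hφ.tendsto_atTop
      refine tendsto_of_tendsto_of_dist (hw i) (squeeze_zero (fun _ => dist_nonneg) (fun n => ?_) h1)
      rw [dist_comm (νₙ (φ n) i)]
      exact dist_dist_dist_le_left _ _ _
  have hmin : ∀ ρ, ∑ i, lam.1 i * w i ≤ dispersion lam ν ρ := fun ρ =>
    le_of_tendsto_of_tendsto' hlim ((hdisp ρ).comp hφ.tendsto_atTop) fun n => hμ (φ n) ρ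
  have hterm : ∀ i, lam.1 i * W1 (ν i) μ ≤ lam.1 i * w i := fun i =>
    mul_le_mul_of_nonneg_left (hle i) (lam.2.1 i)
  have hwi₀ : w i₀ = dist (ν i₀) μ := by
    have h1 : ∑ i, lam.1 i * W1 (ν i) μ = ∑ i, lam.1 i * w i :=
      le_antisymm (Finset.sum_le_sum fun i _ => hterm i) (hmin μ)
    have h2 := (Finset.sum_eq_sum_iff_of_le fun i _ => hterm i).1 h1 i₀ (Finset.mem_univ _)
    exact (mul_left_cancel₀ hi₀.ne' h2).symm
  obtain ⟨ψ, hψ, hconv⟩ := exists_subseq_tendsto_of_tendsto_dist (ν i₀) hnarrow (hwi₀ ▸ hw i₀)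
  exact ⟨μ, fun ρ => (Finset.sum_le_sum fun i _ => hterm i).trans (hmin ρ), φ ∘ ψ, hφ.comp hψ,
    hconv⟩

end Medians

end WassersteinMedian

theorem mainTheorem2 {X : Type*} [MetricSpace X] [ProperSpace X] [MeasurableSpace X]
    [BorelSpace X] (N : ℕ) (hN : 1 ≤ N) :
    (∀ (lam : stdSimplex ℝ (Fin N)) (ν : Fin N → WassersteinMedian.P1 X)
        (lamₙ : ℕ → stdSimplex ℝ (Fin N)) (νₙ : ℕ → Fin N → WassersteinMedian.P1 X)
        (μₙ : ℕ → WassersteinMedian.P1 X),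
        Tendsto (fun n => (∑ i, |(lamₙ n).1 i - lam.1 i|) +
          (⨆ i, WassersteinMedian.W1 (νₙ n i) (ν i))) atTop (𝓝 0) →
        (∀ n, μₙ n ∈ WassersteinMedian.Med (lamₙ n) (νₙ n)) →
        ∃ μ ∈ WassersteinMedian.Med lam ν, ∃ φ : ℕ → ℕ, StrictMono φ ∧
          Tendsto (fun k => WassersteinMedian.W1 (μₙ (φ k)) μ) atTop (𝓝 0)) ∧
    (∀ (lam : stdSimplex ℝ (Fin N)) (ν : Fin N → WassersteinMedian.P1 X),
        IsCompact (WassersteinMedian.Med lam ν)) ∧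
    IsClosed {p : (stdSimplex ℝ (Fin N) × (Fin N → WassersteinMedian.P1 X)) ×
        WassersteinMedian.P1 X | p.2 ∈ WassersteinMedian.Med p.1.1 p.1.2} := by
  refine ⟨fun lam ν lamₙ νₙ μₙ h hμ => ?_, fun lam ν => ?_, ?_⟩
  · have hsum : ∀ n, 0 ≤ ∑ i, |(lamₙ n).1 i - lam.1 i| := fun n =>
      Finset.sum_nonneg fun i _ => abs_nonneg _
    have hsup : ∀ n, 0 ≤ ⨆ i, WassersteinMedian.W1 (νₙ n i) (ν i) := fun n =>
      Real.iSup_nonneg fun i => dist_nonneg (x := νₙ n i) (y := ν i)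
    have hlam : Tendsto lamₙ atTop (𝓝 lam) := by
      refine tendsto_subtype_rng.2 (tendsto_pi_nhds.2 fun i => ?_)
      refine tendsto_iff_dist_tendsto_zero.2 (squeeze_zero (fun _ => dist_nonneg) (fun n => ?_) h)
      refine le_trans ?_ (le_add_of_nonneg_right (hsup n))
      exact Finset.single_le_sum (f := fun i => |(lamₙ n).1 i - lam.1 i|)
        (fun _ _ => abs_nonneg _) (Finset.mem_univ i)
    have hν : Tendsto νₙ atTop (𝓝 ν) := by
      refine tendsto_pi_nhds.2 fun i => ?_
      refine tendsto_iff_dist_tendsto_zero.2 (squeeze_zero (fun _ => dist_nonneg) (fun n => ?_) h)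
      refine le_trans ?_ (le_add_of_nonneg_left (hsum n))
      exact le_ciSup (f := fun i => WassersteinMedian.W1 (νₙ n i) (ν i))
        (Set.finite_range _).bddAbove i
    obtain ⟨μ, hmem, φ, hφ, hlim⟩ :=
      WassersteinMedian.exists_subseq_tendsto_of_mem_Med hlam hν hμ
    exact ⟨μ, hmem, φ, hφ, tendsto_iff_dist_tendsto_zero.1 hlim⟩
  · exact IsSeqCompact.isCompact fun μₙ hμ =>
      WassersteinMedian.exists_subseq_tendsto_of_mem_Med tendsto_const_nhds tendsto_const_nhds hμ
  · have h : {p : (stdSimplex ℝ (Fin N) × (Fin N → WassersteinMedian.P1 X)) ×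
        WassersteinMedian.P1 X | p.2 ∈ WassersteinMedian.Med p.1.1 p.1.2} =
        ⋂ ρ, {p | WassersteinMedian.dispersion p.1.1 p.1.2 p.2 ≤
          WassersteinMedian.dispersion p.1.1 p.1.2 ρ} := by
      ext p
      simp [WassersteinMedian.Med]
    rw [h]
    refine isClosed_iInter fun ρ => isClosed_le WassersteinMedian.continuous_dispersion ?_
    exact WassersteinMedian.continuous_dispersion.comp (continuous_fst.prodMk continuous_const)
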